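/- Rings are associative and unital, ring homomorphisms preserve $1$, and modules are left modules. For a ring $R$ let $\mathcal C_R$ be the set of regular elements of $R$ (elements that are neither left nor right zero divisors), and let $Q_l(R)=\mathcal C_R^{-1}R$ be its classical left quotient ring, the ring of left fractions $c^{-1}r$ with $c\in\mathcal C_R$, $r\in R$; it exists if $\mathcal C_R$ is a left denominator set. The uniform dimension $\mathrm{udim}(M)$ of a module $M$ is the supremum of all $n$ such that $M$ contains a direct sum of $n$ nonzero submodules; $\mathrm{udim}$ of a ring is that of its left regular module. A ring is left Goldie if it has finite left uniform dimension and satisfies the ascending chain condition on left annihilators of subsets; it is semiprime if it has no nonzero nilpotent two-sided ideal. The length of a module $M$ over a ring $A$ is denoted $l_A(M)$. **Theorem.** Let $R$ be a semiprime left Goldie ring and let $\sigma:R\to R$ be a ring endomorphism with $\sigma(\mathcal C_R)\subseteq\mathcal C_R$. Then: 1. The ring $\sigma(R)$ is a semiprime left Goldie ring. 2. The rings $Q_l(R)$ and $Q_l(\sigma(R))$ exist, and $Q_l(R)\simeq\prod_{i=1}^s Q_i$ is a finite product of simple Artinian rings. The rule $c^{-1}r\mapsto\sigma(c)^{-1}\sigma(r)$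 ($c\in\mathcal C_R$, $r\in R$) gives well-defined ring homomorphisms $\sigma_Q:Q_l(R)\to Q_l(R)$, which extends $\sigma$, and $\varphi:Q_l(R)\to Q_l(\sigma(R))$. The map $\varphi$ is a split epimorphism: it is surjective, and there is an isomorphism of (not necessarily unital) rings $Q_l(R)\simeq\ker\varphi\times Q_l(\sigma(R))$ whose second component is $\varphi$ and which sends each $k\in\ker\varphi$ to $(k,0)$. Moreover $Q_l(\sigma(R))=\sigma_Q(Q_l(R))$, in the sense that there is a ring isomorphism $j:Q_l(\sigma(R))\to\sigma_Q(Q_l(R))\subseteq Q_l(R)$ with $j(x/1)=x/1$ for all $x\in\sigma(R)$ and $j\circ\varphi=\sigma_Q$. 3. $\mathrm{udim}(R)=\mathrm{udim}(Q_l(R))=\mathrm{udim}(Q_l(\sigma(R)))+l_{Q_l(R)}(\ker\sigma_Q)=\mathrm{udim}(\sigma(R))+\mathrm{udim}(\ker\sigma)$, where $\ker\sigma$ is regarded as a left $R$-module. -/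

import Mathlib

open OreLocalization
open scoped nonZeroDivisors

universe u v

/-- A ring is semiprime if it has no nonzero nilpotent two-sided ideal. -/
def IsSemiprimeRing (R : Type u) [Ring R] : Prop :=
  ∀ I : Ideal R, I.IsTwoSided → ∀ n : ℕ, I ^ n = ⊥ → I = ⊥

/-- The left annihilator `{r | r * x = 0 for all x ∈ X}` of a subset `X` of a ring. -/
def leftAnnihilator {R : Type u} [Ring R] (X : Set R) : Ideal R where
  carrier := {r | ∀ x ∈ X, r * x = 0}
  zero_mem' := fun x _ => zero_mul x
  add_mem' := fun ha hb x hx => by rw [add_mul, ha x hx, hb x hx, add_zero]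
  smul_mem' := fun c a ha x hx => by rw [smul_eq_mul, mul_assoc, ha x hx, mul_zero]

/-- The ascending chain condition on left annihilators of subsets. -/
def ACCLeftAnnihilators (R : Type u) [Ring R] : Prop :=
  ∀ X : ℕ → Set R, (∀ n, leftAnnihilator (X n) ≤ leftAnnihilator (X (n + 1))) →
    ∃ n, ∀ m, n ≤ m → leftAnnihilator (X m) = leftAnnihilator (X n)

/-- The uniform dimension of a (left) module: the supremum in `ℕ∞` of all `n` such that
`M` contains a direct sum of `n` nonzero submodules. -/
noncomputable def udim (R : Type u) [Ring R] (M : Type v) [AddCommGroup M] [Module R M] : ℕ∞ :=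
  ⨆ n ∈ {n : ℕ | ∃ N : Fin n → Submodule R M, iSupIndep N ∧ ∀ i, N i ≠ ⊥}, (n : ℕ∞)

/-- The left uniform dimension of a ring, i.e. that of its left regular module. -/
noncomputable def leftUdim (R : Type u) [Ring R] : ℕ∞ := udim R R

/-- A left Goldie ring: finite left uniform dimension and a.c.c. on left annihilators. -/
structure IsLeftGoldieRing (R : Type u) [Ring R] : Prop where
  udim_lt_top : leftUdim R < ⊤
  acc : ACCLeftAnnihilators R

/-- The regular elements of `R` (those that are neither left nor right zero divisors) form the
submonoid `R⁰`. When it is a left denominator set, the left quotient ring of `R` is the ring of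
left fractions `c⁻¹ r` (written `r /ₒ c`) with `c` in `R⁰` and `r` in `R`. -/
abbrev LeftQuotientRing (R : Type u) [Ring R] [OreSet R⁰] : Type u :=
  OreLocalization R⁰ R

/-- An endomorphism that respects regular elements maps regular elements of `R` to regular
elements of its image. -/
theorem rangeRestrict_mem_nonZeroDivisors {R : Type u} [Ring R] {σ : R →+* R}
    (hσ : ∀ c ∈ R⁰, σ c ∈ R⁰) (c : R⁰) : σ.rangeRestrict c ∈ (σ.range)⁰ := by
  have h := hσ c c.2
  rw [mem_nonZeroDivisors_iff] at h ⊢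
  refine ⟨fun x hx => Subtype.ext (h.1 x ?_), fun x hx => Subtype.ext (h.2 x ?_)⟩
  · simpa using congrArg Subtype.val hx
  · simpa using congrArg Subtype.val hx

/-! By Goldie's theorem the regular elements of `R` form a left Ore set and `A = Q_l(R)` is
semisimple. Goldie's theorem is proved here from scratch: the singular ideal vanishes, every
essential left ideal contains a regular element, and so `A` has no proper essential left ideal.
Since σ preserves regular elements, it extends to `σQ : A → A`, whose image is a quotient of `A` and
so again semisimple.

The key point is that σ(R) is a left order in `σQ(A)`, because `σQ(c⁻¹ r) = σ(c)⁻¹ σ(r)`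
(`isLeftOrder_rangeNumeratorHom`). A left order in a semisimple ring is left Goldie, and its left
quotient ring is that semisimple ring. Hence `Q_l(σ(R)) ≃ σQ(A)`, and φ is `σQ` followed by this
identification. The kernel of φ is generated by a central idempotent of `A`; this splits φ and also
makes σ(R) semiprime.

For the dimension formula, udim is length over a semisimple ring, so it is additive along `ker σQ →
A → σQ(A)`. Clearing denominators (`IsLeftOrder.udim_comap`) brings each term down to `R` and σ(R),
where `ker σ` is the contraction of `ker σQ`. -/

/-! ### Uniform dimension by independent elements, and its relation to length. -/

section UniformDimension

/-- A finite family of elements is independent if the cyclic submodules it generates are: a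
linear relation between the elements has only zero terms. -/
def IndepElems (R : Type u) [Ring R] {M : Type v} [AddCommGroup M] [Module R M] {n : ℕ}
    (x : Fin n → M) : Prop :=
  ∀ r : Fin n → R, ∑ i, r i • x i = 0 → ∀ i, r i • x i = 0

variable {R : Type u} [Ring R] {M : Type v} [AddCommGroup M] [Module R M]

theorem exists_indepElems_of_iSupIndep {n : ℕ} {N : Fin n → Submodule R M} (hN : iSupIndep N)
    (h0 : ∀ i, N i ≠ ⊥) : ∃ x : Fin n → M, (∀ i, x i ≠ 0) ∧ IndepElems R x := by
  choose x hx hx0 using fun i => (N i).ne_bot_iff.1 (h0 i)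
  refine ⟨x, hx0, fun r hr i => ?_⟩
  have hz := hN i
  rw [Submodule.disjoint_def] at hz
  refine hz _ ((N i).smul_mem _ (hx i)) ?_
  rw [← Finset.add_sum_erase _ _ (Finset.mem_univ i)] at hr
  rw [eq_neg_of_add_eq_zero_left hr]
  refine Submodule.neg_mem _ (Submodule.sum_mem _ fun j hj => ?_)
  exact Submodule.mem_iSup_of_mem j (Submodule.mem_iSup_of_mem (Finset.ne_of_mem_erase hj)
    ((N j).smul_mem _ (hx j)))

theorem IndepElems.iSupIndep_span {n : ℕ} {x : Fin n → M} (hx : IndepElems R x) :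
    iSupIndep fun i => Submodule.span R {x i} := by
  rw [iSupIndep_def]
  intro i
  rw [Submodule.disjoint_def]
  intro y hy hy'
  obtain ⟨a, rfl⟩ := Submodule.mem_span_singleton.1 hy
  obtain ⟨f, hf⟩ : ∃ f : Fin n → R, ∑ j ∈ Finset.univ.erase i, f j • x j = a • x i := by
    have : (⨆ j, ⨆ (_ : j ≠ i), Submodule.span R {x j})
        = Submodule.span R (x '' (↑(Finset.univ.erase i) : Set (Fin n))) := by
      rw [Set.image_eq_iUnion, Submodule.span_iUnion₂]
      simp
    rw [this] at hy'
    obtain ⟨c, hc⟩ := (Submodule.mem_span_image_finset_iff_exists_fun R).1 hy'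
    refine ⟨fun j => if h : j ∈ Finset.univ.erase i then c ⟨j, h⟩ else 0, ?_⟩
    rw [← hc, ← Finset.sum_coe_sort]
    exact Finset.sum_congr rfl fun j _ => by dsimp only; rw [dif_pos j.2]
  have := hx (Function.update (fun j => -f j) i a) (by
    rw [← Finset.add_sum_erase _ _ (Finset.mem_univ i), Function.update_self, ← hf,
      ← Finset.sum_add_distrib]
    refine Finset.sum_eq_zero fun j hj => ?_
    rw [Function.update_of_ne (Finset.ne_of_mem_erase hj), neg_smul, add_neg_cancel]) i
  simpa using this

theorem natCast_le_udim_of_indepElems {n : ℕ} {x : Fin n → M} (h0 : ∀ i, x i ≠ 0)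
    (hx : IndepElems R x) : (n : ℕ∞) ≤ udim R M :=
  le_iSup₂_of_le n ⟨_, hx.iSupIndep_span, fun i => by simpa using h0 i⟩ le_rfl

/-- Testing on elements lets dimensions over different rings be compared without transporting
submodules. -/
theorem udim_le_iff {d : ℕ∞} : udim R M ≤ d ↔
    ∀ (n : ℕ) (x : Fin n → M), (∀ i, x i ≠ 0) → IndepElems R x → (n : ℕ∞) ≤ d := by
  refine ⟨fun h n x h0 hx => (natCast_le_udim_of_indepElems h0 hx).trans h, fun h => ?_⟩
  refine iSup₂_le fun n hn => ?_
  obtain ⟨N, hN, h0⟩ := hn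
  obtain ⟨x, h0, hx⟩ := exists_indepElems_of_iSupIndep hN h0
  exact h n x h0 hx

theorem exists_bound_of_udim_lt_top (h : udim R M < ⊤) : ∃ n : ℕ, ∀ x : Fin n → M,
    (∀ i, x i ≠ 0) → ¬ IndepElems R x := by
  obtain ⟨d, hd⟩ := ENat.ne_top_iff_exists.1 h.ne
  refine ⟨d + 1, fun x h0 hx => ?_⟩
  have := natCast_le_udim_of_indepElems h0 hx
  rw [← hd] at this
  norm_cast at this
  omega

theorem udim_le_length : udim R M ≤ Module.length R M := by
  classical
  refine iSup₂_le fun n hn => ?_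
  obtain ⟨N, hN, h0⟩ := hn
  have hinj := hN.dfinsupp_lsum_injective
  have h1 : Module.length R (∀ i, N i) ≤ Module.length R M :=
    Module.length_le_of_injective
      ((DFinsupp.lsum ℕ fun i => (N i).subtype) ∘ₗ
        (DFinsupp.linearEquivFunOnFintype (R := R) (M := fun i => N i)).symm.toLinearMap)
      (hinj.comp
        (DFinsupp.linearEquivFunOnFintype (R := R) (M := fun i => N i)).symm.injective)
  refine le_trans ?_ h1
  rw [Module.length_pi_of_fintype]
  calc (n : ℕ∞) = ∑ _i : Fin n, 1 := by simp
    _ ≤ _ := Finset.sum_le_sum fun i _ => by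
      have : Nontrivial (N i) := Submodule.nontrivial_iff_ne_bot.2 (h0 i)
      exact Order.one_le_iff_pos.2 Module.length_pos

/-- The module is a direct sum of finitely many simple submodules, as many as its length; one
nonzero element from each gives an independent family. -/
theorem udim_eq_length [IsSemisimpleModule R M] [Module.Finite R M] :
    udim R M = Module.length R M := by
  classical
  refine le_antisymm udim_le_length ?_
  obtain ⟨n, S, e, hS⟩ := IsSemisimpleModule.exists_linearEquiv_fin_dfinsupp R M
  have h1 : Module.length R M = n := by
    rw [(e.trans DFinsupp.linearEquivFunOnFintype).length_eq, Module.length_pi_of_fintype]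
    simp [Module.length_eq_one]
  have hx := fun i => (nontrivial_iff_exists_ne (0 : S i)).1
    (IsSimpleModule.nontrivial R (S i))
  choose x hx using hx
  rw [h1]
  refine natCast_le_udim_of_indepElems (R := R) (x := fun i => e.symm (DFinsupp.single i (x i)))
    (fun i => by simpa using hx i) fun r hr i => ?_
  simp_rw [← map_smul, ← map_sum] at hr ⊢
  rw [e.symm.map_eq_zero_iff] at hr ⊢
  have := DFunLike.congr_fun hr i
  rw [DFinsupp.finsetSum_apply, Finset.sum_eq_single i] at this
  · ext j
    by_cases hj : j = i
    · subst hj; exact congrArg _ this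
    · simp [DFinsupp.single_apply, Ne.symm hj]
  · intro j _ hj
    simp [DFinsupp.single_apply, hj]
  · simp

end UniformDimension

/-! ### Goldie's theorem for semiprime left Goldie rings. -/

section Goldie

variable {R : Type u} [Ring R]

/-- A left ideal is essential if it meets every nonzero left ideal, elementwise. -/
def LeftEssential (E : Ideal R) : Prop := ∀ x : R, x ≠ 0 → ∃ r, r * x ≠ 0 ∧ r * x ∈ E

theorem LeftEssential.mono {E F : Ideal R} (h : LeftEssential E) (hEF : E ≤ F) :
    LeftEssential F := fun x hx =>
  let ⟨r, h0, hr⟩ := h x hx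
  ⟨r, h0, hEF hr⟩

/-- The left ideal `(E : a) = {r | r * a ∈ E}`. -/
def leftColon (E : Ideal R) (a : R) : Ideal R :=
  Submodule.comap (LinearMap.toSpanSingleton R R a) E

theorem mem_leftColon {E : Ideal R} {a r : R} : r ∈ leftColon E a ↔ r * a ∈ E :=
  Iff.rfl

theorem LeftEssential.colon {E : Ideal R} (h : LeftEssential E) (a : R) :
    LeftEssential (leftColon E a) := by
  intro x hx
  by_cases h0 : x * a = 0
  · exact ⟨1, by simpa using hx, by simp [mem_leftColon, h0]⟩
  · obtain ⟨r, hr, hrE⟩ := h _ h0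
    refine ⟨r, fun h => hr (by rw [← mul_assoc, h, zero_mul]), ?_⟩
    rwa [mem_leftColon, mul_assoc]

theorem mem_leftAnnihilator_singleton {a r : R} : r ∈ leftAnnihilator {a} ↔ r * a = 0 := by
  change (∀ x ∈ ({a} : Set R), r * x = 0) ↔ _
  simp

/-- In a semiprime ring, `x R x = 0` implies `x = 0`. -/
theorem IsSemiprimeRing.eq_zero (h : IsSemiprimeRing R) {x : R} (hx : ∀ r, x * r * x = 0) :
    x = 0 := by
  -- This is the two-sided ideal `R x R`; the hypothesis `x R x = 0` makes its square zero.
  let I : Ideal R := Ideal.span (Set.range fun s => x * s)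
  have hI : I.IsTwoSided := by
    refine ⟨fun {a} b ha => ?_⟩
    induction ha using Submodule.span_induction with
    | mem y hy =>
      obtain ⟨s, rfl⟩ := hy
      exact Ideal.subset_span ⟨s * b, (mul_assoc _ _ _).symm⟩
    | zero => simp
    | add y z _ _ hy hz => rw [add_mul]; exact I.add_mem hy hz
    | smul c y _ hy => rw [smul_eq_mul, mul_assoc]; exact I.mul_mem_left c hy
  have h1 : ∀ a ∈ I, ∀ r, x * r * a = 0 := by
    intro a ha
    induction ha using Submodule.span_induction with
    | mem y hy =>
      obtain ⟨s, rfl⟩ := hy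
      exact fun r => by rw [← mul_assoc, hx, zero_mul]
    | zero => simp
    | add y z _ _ hy hz => exact fun r => by rw [mul_add, hy, hz, add_zero]
    | smul c y _ hy => exact fun r => by rw [smul_eq_mul, ← mul_assoc, mul_assoc x, hy]
  have h2 : I ^ 2 = ⊥ := by
    rw [Submodule.pow_succ, Submodule.pow_one, eq_bot_iff]
    refine Ideal.mul_le.2 fun b hb a ha => ?_
    rw [Submodule.mem_bot]
    induction hb using Submodule.span_induction with
    | mem y hy => obtain ⟨s, rfl⟩ := hy; exact h1 a ha s
    | zero => simp
    | add y z _ _ hy hz => rw [add_mul, hy, hz, add_zero]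
    | smul c y _ hy => rw [smul_eq_mul, mul_assoc, hy, mul_zero]
  have h3 : x ∈ I := Ideal.subset_span ⟨1, mul_one x⟩
  rw [h I hI 2 h2] at h3
  exact h3

theorem isSemiprimeRing_of_forall (h : ∀ x : R, (∀ r, x * r * x = 0) → x = 0) :
    IsSemiprimeRing R := by
  intro I _ n
  have key : ∀ n, I ^ (n + 1) = ⊥ → I = ⊥ := by
    intro n
    induction n with
    | zero => simp [Submodule.pow_one]
    | succ n ih =>
      intro hn
      -- The nilpotency exponent drops by one: for `x ∈ I ^ (n + 1)`, the product `x r x` lies in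
      -- `(I ^ (n + 1))²`, hence in `I ^ (n + 2) = 0`.
      refine ih ((Submodule.eq_bot_iff _).2 fun x hx => h x fun r => ?_)
      have h1 : x * (r * x) ∈ I ^ (n + 1) * I ^ (n + 1) :=
        Ideal.mul_mem_mul hx (Ideal.mul_mem_left _ r hx)
      have h2 : I ^ (n + 1) * I ^ (n + 1) ≤ I ^ (n + 1 + 1) := by
        rw [Submodule.pow_succ (n := n + 1)]
        exact Ideal.mul_mono_right (Ideal.pow_le_self n.succ_ne_zero)
      have h3 := h2 h1
      rw [hn] at h3
      rw [mul_assoc]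
      exact h3
  cases n with
  | zero =>
    intro h0
    rw [Submodule.pow_zero, Ideal.one_eq_top] at h0
    exact le_bot_iff.1 (h0 ▸ le_top)
  | succ n => exact key n

/-- Among the nonzero elements of a set there is one whose left annihilator is not properly
contained in that of another, if there is a nonzero element at all. -/
theorem ACCLeftAnnihilators.exists_max (h : ACCLeftAnnihilators R) (S : Set R) (hS : S.Nonempty) :
    ∃ a ∈ S, ∀ b ∈ S, (∀ r, r * a = 0 → r * b = 0) → ∀ r, r * b = 0 → r * a = 0 := by
  let A := {I : Ideal R // ∃ a ∈ S, I = leftAnnihilator {a}}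
  have hA : WellFoundedGT A := by
    rw [wellFoundedGT_iff_monotone_chain_condition]
    intro f
    choose a ha hfa using fun n => (f n).2
    obtain ⟨n, hn⟩ := h (fun n => {a n}) fun n => by
      rw [← hfa, ← hfa]; exact f.monotone (Nat.le_succ n)
    exact ⟨n, fun m hm => Subtype.ext (by rw [hfa, hfa, hn m hm])⟩
  obtain ⟨s, hs⟩ := hS
  obtain ⟨⟨I, a, ha, rfl⟩, -, hmax⟩ := hA.wf.has_min Set.univ
    ⟨⟨leftAnnihilator {s}, s, hs, rfl⟩, trivial⟩
  refine ⟨a, ha, fun b hb hab r hr => ?_⟩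
  by_contra hra
  refine hmax ⟨leftAnnihilator {b}, b, hb, rfl⟩ trivial ?_
  change leftAnnihilator {a} < leftAnnihilator {b}
  refine lt_of_le_of_ne (fun r hr => ?_) fun heq => hra ?_
  · rw [mem_leftAnnihilator_singleton] at hr ⊢; exact hab r hr
  · rwa [← mem_leftAnnihilator_singleton, heq, mem_leftAnnihilator_singleton]

/-- The left singular ideal of a semiprime ring with a.c.c. on left annihilators is zero. -/
theorem eq_zero_of_leftEssential_annihilator (hsp : IsSemiprimeRing R)
    (hacc : ACCLeftAnnihilators R) {a : R} (ha : LeftEssential (leftAnnihilator {a})) : a = 0 := by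
  by_contra ha0
  obtain ⟨a, ⟨h0, ha⟩, hmax⟩ := hacc.exists_max
    {a | a ≠ 0 ∧ LeftEssential (leftAnnihilator {a})} ⟨a, ha0, ha⟩
  refine h0 (hsp.eq_zero fun x => ?_)
  by_contra hne
  have hess : LeftEssential (leftAnnihilator {a * x * a}) :=
    ha.mono fun r hr => by
      rw [mem_leftAnnihilator_singleton] at hr ⊢
      rw [mul_assoc a, ← mul_assoc, hr, zero_mul]
  have hxa : LeftEssential (leftAnnihilator {x * a}) :=
    (ha.colon x).mono fun r hr => by
      rw [mem_leftColon, mem_leftAnnihilator_singleton] at hr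
      rwa [mem_leftAnnihilator_singleton, ← mul_assoc]
  -- Essentiality of the annihilator of `x a`, tested on `a`, gives `r a ≠ 0` with `r a x a = 0`. By
  -- maximality `a` and `a x a` have the same left annihilator, a contradiction.
  obtain ⟨r, hr, hr'⟩ := hxa a h0
  rw [mem_leftAnnihilator_singleton] at hr'
  refine hr (hmax _ ⟨hne, hess⟩ (fun s hs => by rw [← mul_assoc, ← mul_assoc, hs]; simp) r ?_)
  rw [← hr']; noncomm_ring

/-- In a semiprime ring with a.c.c. on left annihilators, a nonzero left ideal contains a nonzero
element `w` such that `w` and `w ^ 2` have the same left annihilator. -/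
theorem exists_mem_annihilator_sq (hsp : IsSemiprimeRing R) (hacc : ACCLeftAnnihilators R)
    {L : Ideal R} (hL : ∃ y ∈ L, y ≠ 0) :
    ∃ w ∈ L, w ≠ 0 ∧ ∀ r, r * w * w = 0 → r * w = 0 := by
  obtain ⟨y, hy, hy0⟩ := hL
  obtain ⟨b, ⟨hb0, y, hy, x, rfl⟩, hmax⟩ := hacc.exists_max
    {b | b ≠ 0 ∧ ∃ y ∈ L, ∃ x, b = y * x} ⟨y, hy0, y, hy, 1, (mul_one y).symm⟩
  obtain ⟨r, hr⟩ : ∃ r, y * x * r * (y * x) ≠ 0 := by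
    by_contra! h
    exact hb0 (hsp.eq_zero h)
  have hcancel : ∀ s, s * (y * x * r * (y * x)) = 0 → s * (y * x) = 0 :=
    hmax _ ⟨hr, y, hy, x * r * (y * x), by noncomm_ring⟩ fun s hs => by
      rw [mul_assoc (y * x), ← mul_assoc s, hs, zero_mul]
  -- With `b = y x`, maximality gives `b r b` the left annihilator of `b`. The rotated product `t`
  -- lies in `L`, which `b` need not do. The annihilators of `t²` and `t³` coincide, so `w = t²`
  -- works.
  set t := x * r * y with ht
  have h1 : ∀ s, s * t * t = 0 → s * t * x = 0 := fun s hs => by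
    have : s * x * r * (y * x) = 0 := hcancel _ (by
      calc s * x * r * (y * x * r * (y * x)) = s * t * t * x := by rw [ht]; noncomm_ring
        _ = 0 := by rw [hs, zero_mul])
    rw [← this, ht]; noncomm_ring
  have h2 : ∀ s, s * t * x = 0 → s * t * t = 0 := fun s hs => by
    calc s * t * t = s * t * x * (r * y) := by rw [ht]; noncomm_ring
      _ = 0 := by rw [hs, zero_mul]
  have h3 : ∀ s, s * t * t * t = 0 → s * t * t = 0 := fun s hs => by
    have h := h1 _ hs
    have : s * x * r * (y * x) = 0 := hcancel _ (by
      rw [← h, ht]; noncomm_ring)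
    exact h2 s (by rw [← this, ht]; noncomm_ring)
  refine ⟨t * t, L.mul_mem_left _ (L.mul_mem_left _ hy), fun h => hr ?_, fun s hs => ?_⟩
  · have := h1 1 (by rw [one_mul, h])
    calc y * x * r * (y * x) = y * (1 * t * x) := by rw [ht]; noncomm_ring
      _ = 0 := by rw [this, mul_zero]
  · rw [← mul_assoc]
    refine h3 _ (h3 _ ?_)
    rw [← hs]; noncomm_ring

/-- If `R x ∩ R c = 0` with `x ≠ 0`, then `x, x c, x c², …` are independent: in a relation the first
term lies in `R c`, so it vanishes, and `c` cancels from the rest. This contradicts finite uniform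
dimension. -/
theorem leftEssential_span_of_forall (hu : leftUdim R < ⊤) {c : R}
    (hc : ∀ r, r * c = 0 → r = 0) : LeftEssential (Ideal.span {c}) := by
  intro x hx
  by_contra! h
  obtain ⟨n, hn⟩ := exists_bound_of_udim_lt_top hu
  have hpow : ∀ (i : ℕ) (r : R), r * c ^ i = 0 → r = 0 := by
    intro i
    induction i with
    | zero => simp
    | succ i ih => exact fun r hr => ih r (hc _ (by rw [mul_assoc, ← pow_succ, hr]))
  refine hn (fun i => x * c ^ (i : ℕ)) (fun i hi => hx (hpow _ _ hi)) ?_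
  clear hn
  induction n with
  | zero => exact fun _ _ i => i.elim0
  | succ n ih =>
    intro r hr
    have hsum : r 0 * x + (∑ i : Fin n, r i.succ * (x * c ^ (i : ℕ))) * c = 0 := by
      rw [Fin.sum_univ_succ] at hr
      simpa [Finset.sum_mul, pow_succ, mul_assoc] using hr
    have h0 : r 0 * x = 0 := by
      by_contra hne
      refine h _ hne ?_
      rw [eq_neg_of_add_eq_zero_left hsum]
      exact Submodule.neg_mem _ (Ideal.mul_mem_left _ _ (Ideal.mem_span_singleton_self c))
    rw [h0, zero_add] at hsum
    refine Fin.cases (by simpa using h0) fun i => ?_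
    have := ih (fun i => r i.succ) (by simpa using hc _ hsum) i
    simp only [smul_eq_mul] at this
    simp only [smul_eq_mul, Fin.val_succ, pow_succ]
    rw [← mul_assoc x, ← mul_assoc (r _), this, zero_mul]

/-- In a semiprime left Goldie ring, an element with zero left annihilator is regular. -/
theorem mem_nonZeroDivisors_of_forall (hsp : IsSemiprimeRing R) (hG : IsLeftGoldieRing R) {c : R}
    (hc : ∀ r, r * c = 0 → r = 0) : c ∈ R⁰ := by
  refine mem_nonZeroDivisors_iff.2 ⟨fun x hx => ?_, hc⟩
  -- If `c x = 0`, the left annihilator of `x` contains the essential left ideal `R c`.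
  refine eq_zero_of_leftEssential_annihilator hsp hG.acc
    ((leftEssential_span_of_forall hG.udim_lt_top hc).mono ?_)
  rw [Ideal.span_le, Set.singleton_subset_iff]
  exact mem_leftAnnihilator_singleton.2 hx

/-- **Goldie**: an essential left ideal of a semiprime left Goldie ring contains a regular
element. -/
theorem LeftEssential.exists_mem_nonZeroDivisors (hsp : IsSemiprimeRing R)
    (hG : IsLeftGoldieRing R) {E : Ideal R} (hE : LeftEssential E) : ∃ c ∈ E, c ∈ R⁰ := by
  by_contra! hno
  obtain ⟨n, hn⟩ := exists_bound_of_udim_lt_top hG.udim_lt_top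
  -- While `c ∈ E` is not regular, its left annihilator meets `E` and supplies an `a` with `a c =
  -- 0`. Replacing `c` by `c + a` and adding `a` to the family keeps the sum of the `R xᵢ` direct
  -- and disjoint from the annihilator of `c`. The family would grow without bound.
  have key : ∀ n : ℕ, ∃ c ∈ E, (∀ r, r * c * c = 0 → r * c = 0) ∧ ∃ x : Fin n → R,
      (∀ i, x i ≠ 0) ∧ ∀ r : Fin n → R, (∑ i, r i * x i) * c = 0 → ∀ i, r i * x i = 0 := by
    intro n
    induction n with
    | zero => exact ⟨0, E.zero_mem, by simp, Fin.elim0, fun i => i.elim0, fun _ _ i => i.elim0⟩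
    | succ n ih =>
      obtain ⟨c, hcE, hc, x, hx0, hx⟩ := ih
      obtain ⟨y, hyc, hy0⟩ : ∃ y, y * c = 0 ∧ y ≠ 0 := by
        by_contra! h
        exact hno c hcE (mem_nonZeroDivisors_of_forall hsp hG h)
      obtain ⟨a, ⟨haE, hac⟩, ha0, ha⟩ := exists_mem_annihilator_sq hsp hG.acc
        (L := E ⊓ leftAnnihilator {c}) (by
          obtain ⟨r, hr, hrE⟩ := hE y hy0
          exact ⟨_, ⟨hrE, mem_leftAnnihilator_singleton.2 (by rw [mul_assoc, hyc, mul_zero])⟩, hr⟩)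
      have hac : a * c = 0 := mem_leftAnnihilator_singleton.1 hac
      -- As `a c = 0`, right multiplication by `c` turns `r (c + a) = 0` into `r c² = 0`.
      have hsum : ∀ r, r * (c + a) = 0 → r * c = 0 ∧ r * a = 0 := fun r hr => by
        have h1 : r * c = 0 := hc r (by
          calc r * c * c = r * (c + a) * c - r * (a * c) := by noncomm_ring
            _ = 0 := by rw [hr, hac]; simp)
        exact ⟨h1, by simpa [mul_add, h1] using hr⟩
      refine ⟨c + a, E.add_mem hcE haE, fun r hr => ?_, Fin.cons a x,
        Fin.cases ha0 hx0, fun r hr => ?_⟩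
      · obtain ⟨h1, h2⟩ := hsum _ hr
        have h3 : r * c = 0 := hc r (by
          calc r * c * c = r * (c + a) * c - r * (a * c) := by noncomm_ring
            _ = 0 := by rw [h1, hac]; simp)
        have h4 : r * a = 0 := ha r (by
          calc r * a * a = r * (c + a) * a - r * c * a := by noncomm_ring
            _ = 0 := by rw [h2, h3]; simp)
        rw [mul_add, h3, h4, add_zero]
      · simp only [Fin.sum_univ_succ, Fin.cons_zero, Fin.cons_succ] at hr
        obtain ⟨h1, h2⟩ := hsum _ hr
        have h3 := hx (fun i => r i.succ) (by
          rw [add_mul, mul_assoc, hac, mul_zero, zero_add] at h1; exact h1)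
        rw [Finset.sum_eq_zero fun i _ => h3 i, add_zero] at h2
        exact Fin.cases (by simpa using ha _ h2) (by simpa using h3)
  obtain ⟨c, -, -, x, hx0, hx⟩ := key n
  exact hn x hx0 fun r hr => hx r (by simp only [smul_eq_mul] at hr; rw [hr, zero_mul])

/-- The regular elements of a semiprime left Goldie ring form a left Ore set. -/
theorem nonempty_oreSet_nonZeroDivisors (hsp : IsSemiprimeRing R) (hG : IsLeftGoldieRing R) :
    Nonempty (OreSet R⁰) := by
  refine nonempty_oreSet_iff.2 ⟨fun r₁ r₂ s h => ⟨1, ?_⟩, fun r s => ?_⟩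
  · rw [← sub_eq_zero, ← sub_mul] at h
    rw [sub_eq_zero.1 ((mem_nonZeroDivisors_iff.1 s.2).2 _ h)]
  -- The left ideal `(R s : r)` is essential; a regular `c` in it gives the Ore condition `c r ∈ R
  -- s`.
  · have hs := leftEssential_span_of_forall hG.udim_lt_top (mem_nonZeroDivisors_iff.1 s.2).2
    obtain ⟨c, hc, hcR⟩ := (hs.colon r).exists_mem_nonZeroDivisors hsp hG
    obtain ⟨r', hr'⟩ := Ideal.mem_span_singleton'.1 (mem_leftColon.1 hc)
    exact ⟨r', ⟨c, hcR⟩, hr'.symm⟩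

/-- A ring without proper essential left ideals is semisimple. -/
theorem isSemisimpleRing_of_leftEssential (h : ∀ E : Ideal R, LeftEssential E → E = ⊤) :
    IsSemisimpleRing R := by
  refine (isSemisimpleModule_iff R R).2 ⟨fun J => ?_⟩
  -- For `K` maximal with `J ∩ K = 0`, the sum `J + K` is essential, so it is everything.
  obtain ⟨K, -, hK⟩ := zorn_le_nonempty₀ {K : Ideal R | Disjoint J K}
    (fun c hc hchain y hy => ⟨sSup c, hchain.directedOn.disjoint_sSup_right.2 fun K hK => hc hK,
      fun z hz => le_sSup hz⟩) ⊥ disjoint_bot_right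
  refine ⟨K, hK.prop, codisjoint_iff.2 (h _ fun x hx => ?_)⟩
  by_contra! hx'
  have hd : Disjoint (J ⊔ K) (Ideal.span {x}) := by
    rw [Submodule.disjoint_def]
    intro y hy hyx
    obtain ⟨r, rfl⟩ := Ideal.mem_span_singleton'.1 hyx
    by_contra hne
    exact hx' r hne hy
  have hmem : x ∈ K := by
    have : K ⊔ Ideal.span {x} ≤ K := hK.le_of_ge
      (hK.prop.disjoint_sup_right_of_disjoint_sup_left hd) le_sup_left
    exact this (Ideal.mem_sup_right (Ideal.mem_span_singleton_self x))
  exact hx' 1 (by simpa using hx) (by rw [one_mul]; exact Ideal.mem_sup_right hmem)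

end Goldie

/-! ### Uniform dimension along injective linear maps. -/

section UdimTransfer

variable {R : Type u} [Ring R] {M N : Type*} [AddCommGroup M] [Module R M]
  [AddCommGroup N] [Module R N]

theorem udim_le_of_injective (f : M →ₗ[R] N) (hf : Function.Injective f) :
    udim R M ≤ udim R N :=
  udim_le_iff.2 fun _ x h0 hx => natCast_le_udim_of_indepElems (x := f ∘ x)
    (fun i => by simpa [map_eq_zero_iff f hf] using h0 i)
    fun r hr i => by
      simp only [Function.comp_apply, ← map_smul, ← map_sum, map_eq_zero_iff f hf] at hr ⊢
      exact hx r hr i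

theorem LinearEquiv.udim_eq (f : M ≃ₗ[R] N) : udim R M = udim R N :=
  le_antisymm (udim_le_of_injective f.toLinearMap f.injective)
    (udim_le_of_injective f.symm.toLinearMap f.symm.injective)

end UdimTransfer

/-! ### Left orders: transfer between a ring and its ring of left fractions. -/

section LeftOrder

/-- `ι` presents `T` as a left order in `A`: it is injective and every element of `A` is a left
fraction of elements of `T`. -/
structure IsLeftOrder {T A : Type*} [Ring T] [Ring A] (ι : T →+* A) : Prop where
  injective : Function.Injective ι
  exists_fraction : ∀ a, ∃ c t, IsUnit (ι c) ∧ ι c * a = ι t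

namespace IsLeftOrder

variable {T A : Type*} [Ring T] [Ring A] {ι : T →+* A} (h : IsLeftOrder ι)

include h

theorem exists_common_denominator {n : ℕ} (a : Fin n → A) :
    ∃ c, IsUnit (ι c) ∧ ∃ t : Fin n → T, ∀ i, ι c * a i = ι (t i) := by
  induction n with
  | zero => exact ⟨1, by simp, Fin.elim0, fun i => i.elim0⟩
  | succ n ih =>
    obtain ⟨c, hc, t, ht⟩ := ih (fun i => a i.succ)
    obtain ⟨d, s, hd, hs⟩ := h.exists_fraction (ι c * a 0)
    refine ⟨d * c, by rw [map_mul]; exact hd.mul hc, Fin.cons s fun i => d * t i,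
      Fin.cases ?_ fun i => ?_⟩
    · rw [map_mul, mul_assoc, hs, Fin.cons_zero]
    · rw [map_mul, mul_assoc, ht, Fin.cons_succ, map_mul]

/-- Independent families pass both ways: a relation over `A` becomes one over `T` after multiplying
by a common left denominator, and an element of `J` becomes a numerator in the contraction after
multiplying by its own. -/
theorem udim_comap (J : Ideal A) : udim T (J.comap ι) = udim A J := by
  refine le_antisymm (udim_le_iff.2 fun n x h0 hx => ?_) (udim_le_iff.2 fun n x h0 hx => ?_)
  · refine natCast_le_udim_of_indepElems (x := fun i => (⟨ι (x i), (x i).2⟩ : J))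
      (fun i hi => h0 i ?_) fun r hr i => ?_
    · rw [Subtype.ext_iff] at hi
      exact Subtype.ext ((map_eq_zero_iff ι h.injective).1 hi)
    · obtain ⟨c, hc, t, ht⟩ := h.exists_common_denominator r
      have key : ∀ j, ι (t j * x j) = ι c * (r j * ι (x j)) := fun j => by
        rw [map_mul, ← ht, mul_assoc]
      have hz := hx t (by
        refine Subtype.ext (h.injective ?_)
        have := congrArg Subtype.val hr
        simp only [AddSubmonoidClass.coe_finsetSum, SetLike.val_smul, smul_eq_mul,
          ZeroMemClass.coe_zero] at this ⊢
        rw [map_sum, Finset.sum_congr rfl fun j _ => key j, ← Finset.mul_sum, this]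
        simp) i
      have hz' : t i * x i = 0 := congrArg Subtype.val hz
      refine Subtype.ext (hc.mul_right_eq_zero.1 ?_)
      change ι c * (r i * ι (x i)) = 0
      rw [← key, hz', map_zero]
  · choose c t hc ht using fun i => h.exists_fraction (x i : A)
    refine natCast_le_udim_of_indepElems
      (x := fun i => (⟨t i, by
        rw [Ideal.mem_comap, ← ht]; exact J.mul_mem_left _ (x i).2⟩ : J.comap ι))
      (fun i hi => h0 i ?_) fun r hr i => ?_
    · have hi : t i = 0 := congrArg Subtype.val hi
      refine Subtype.ext ((hc i).mul_right_eq_zero.1 ?_)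
      rw [ht, hi, map_zero]
    · have key : ∀ j, ι (r j * t j) = ι (r j * c j) * x j := fun j => by
        rw [map_mul, ← ht, map_mul, mul_assoc]
      have hz := hx (fun j => ι (r j * c j)) (by
        refine Subtype.ext ?_
        have := congrArg Subtype.val hr
        simp only [AddSubmonoidClass.coe_finsetSum, SetLike.val_smul, smul_eq_mul,
          ZeroMemClass.coe_zero] at this ⊢
        rw [← Finset.sum_congr rfl fun j _ => key j, ← map_sum, this, map_zero]) i
      have hz' : ι (r i * c i) * x i = 0 := congrArg Subtype.val hz
      refine Subtype.ext (h.injective ?_)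
      change ι (r i * t i) = ι 0
      rw [key, hz', map_zero]

theorem leftUdim_eq : leftUdim T = leftUdim A := by
  have := h.udim_comap ⊤
  rw [Ideal.comap_top, Submodule.topEquiv.udim_eq, Submodule.topEquiv.udim_eq] at this
  exact this

theorem leftEssential_comap {E : Ideal A} (hE : LeftEssential E) :
    LeftEssential (E.comap ι) := by
  intro x hx
  obtain ⟨a, ha0, ha⟩ := hE (ι x) (by rwa [Ne, map_eq_zero_iff ι h.injective])
  obtain ⟨c, t, hc, ht⟩ := h.exists_fraction a
  have key : ι (t * x) = ι c * (a * ι x) := by rw [map_mul, ← ht, mul_assoc]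
  refine ⟨t, fun h0 => ha0 (hc.mul_right_eq_zero.1 (by rw [← key, h0, map_zero])), ?_⟩
  rw [Ideal.mem_comap, key]
  exact E.mul_mem_left _ ha

/-- An essential left ideal of `A` contracts to an essential one of `T`, which contains a regular
element, and this is a unit in `A`. -/
theorem isSemisimpleRing (hsp : IsSemiprimeRing T) (hG : IsLeftGoldieRing T)
    (hu : ∀ c ∈ T⁰, IsUnit (ι c)) : IsSemisimpleRing A := by
  refine isSemisimpleRing_of_leftEssential fun E hE => ?_
  obtain ⟨c, hcE, hc⟩ := (h.leftEssential_comap hE).exists_mem_nonZeroDivisors hsp hG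
  exact E.eq_top_of_isUnit_mem hcE (hu c hc)

/-- Right multiplication by `ι c` is injective, as seen on numerators, hence surjective on the
Artinian module `A`. This gives a left inverse, which injectivity makes two-sided. -/
theorem isUnit_map [IsArtinianRing A] {c : T} (hc : c ∈ T⁰) : IsUnit (ι c) := by
  have hinj : Function.Injective (LinearMap.toSpanSingleton A A (ι c)) := by
    rw [injective_iff_map_eq_zero]
    intro a ha
    obtain ⟨d, t, hd, ht⟩ := h.exists_fraction a
    have ha : a * ι c = 0 := ha
    have : t * c = 0 := h.injective (by rw [map_mul, ← ht, mul_assoc, ha, mul_zero, map_zero])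
    rw [(mem_nonZeroDivisors_iff.1 hc).2 t this, map_zero] at ht
    exact hd.mul_right_eq_zero.1 ht
  obtain ⟨b, hb⟩ := IsArtinian.surjective_of_injective_endomorphism _ hinj 1
  have hb : b * ι c = 1 := hb
  refine ⟨⟨ι c, b, sub_eq_zero.1 (hinj ?_), hb⟩, rfl⟩
  change (ι c * b - 1) * ι c = 0 * ι c
  rw [sub_mul, mul_assoc, hb]
  simp

theorem mem_nonZeroDivisors {c : T} (hc : IsUnit (ι c)) : c ∈ T⁰ := by
  refine mem_nonZeroDivisors_iff.2 ⟨fun x hx => ?_, fun x hx => ?_⟩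
  · refine (map_eq_zero_iff ι h.injective).1 (hc.mul_right_eq_zero.1 ?_)
    rw [← map_mul, hx, map_zero]
  · refine (map_eq_zero_iff ι h.injective).1 (hc.mul_left_eq_zero.1 ?_)
    rw [← map_mul, hx, map_zero]

theorem nonempty_oreSet [IsArtinianRing A] : Nonempty (OreSet T⁰) := by
  refine nonempty_oreSet_iff.2 ⟨fun r₁ r₂ s hs => ⟨1, ?_⟩, fun r s => ?_⟩
  · rw [← sub_eq_zero, ← sub_mul] at hs
    rw [sub_eq_zero.1 ((mem_nonZeroDivisors_iff.1 s.2).2 _ hs)]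
  · obtain ⟨u, hu⟩ := h.isUnit_map s.2
    -- Rewriting the right fraction `r s⁻¹` as a left fraction `c⁻¹ t` gives `c r = t s`.
    obtain ⟨c, t, hc, ht⟩ := h.exists_fraction (ι r * ↑u⁻¹)
    refine ⟨t, ⟨c, h.mem_nonZeroDivisors hc⟩, h.injective ?_⟩
    rw [map_mul, map_mul, ← ht, ← hu]
    simp [mul_assoc]

/-- The left ideals of `A` generated by the annihilators stabilize, and each still annihilates its
set, so the annihilators in `T` can be recovered from them. -/
theorem accLeftAnnihilators [IsNoetherianRing A] : ACCLeftAnnihilators T := by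
  intro X hX
  obtain ⟨n, hn⟩ := monotone_stabilizes_iff_noetherian.2 ‹IsNoetherianRing A›
    ⟨fun n => Ideal.span (ι '' leftAnnihilator (X n)),
      monotone_nat_of_le_succ fun n => Ideal.span_mono (Set.image_mono (hX n))⟩
  refine ⟨n, fun m hm => le_antisymm (fun r hr x hx => ?_)
    (monotone_nat_of_le_succ (f := fun n => leftAnnihilator (X n)) hX hm)⟩
  have hr' : ι r ∈ Ideal.span (ι '' leftAnnihilator (X n)) := by
    have hnm : Ideal.span (ι '' leftAnnihilator (X n)) = Ideal.span (ι '' leftAnnihilator (X m)) :=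
      hn m hm
    rw [hnm]
    exact Ideal.subset_span ⟨r, hr, rfl⟩
  have hle : Ideal.span (ι '' leftAnnihilator (X n)) ≤ leftAnnihilator {ι x} := by
    rw [Ideal.span_le]
    rintro _ ⟨s, hs, rfl⟩
    refine mem_leftAnnihilator_singleton.2 ?_
    rw [← map_mul, hs x hx, map_zero]
  have := mem_leftAnnihilator_singleton.1 (hle hr')
  rw [← map_mul] at this
  exact (map_eq_zero_iff ι h.injective).1 this

theorem isLeftGoldieRing [IsSemisimpleRing A] : IsLeftGoldieRing T where
  udim_lt_top := by
    rw [h.leftUdim_eq]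
    exact lt_of_le_of_lt udim_le_length Module.length_ne_top.lt_top
  acc := h.accLeftAnnihilators

/-- A left order in an Artinian ring has that ring as its left quotient ring. -/
theorem exists_ringEquiv [IsArtinianRing A] [OreSet T⁰] :
    ∃ j : LeftQuotientRing T ≃+* A, ∀ (t : T) (c : T⁰), ι c * j (t /ₒ c) = ι t := by
  let fS : T⁰ →* Aˣ :=
    IsUnit.liftRight (ι.toMonoidHom.comp T⁰.subtype) fun c => h.isUnit_map c.2
  have hf : ∀ c : T⁰, ι c = fS c := fun c =>
    (IsUnit.coe_liftRight (ι.toMonoidHom.comp T⁰.subtype) (fun c => h.isUnit_map c.2) c).symm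
  have hj : ∀ (t : T) (c : T⁰), ι c * universalHom ι fS hf (t /ₒ c) = ι t := fun t c => by
    rw [universalHom_apply, hf, Units.mul_inv_cancel_left]
  refine ⟨RingEquiv.ofBijective (universalHom ι fS hf) ⟨?_, fun a => ?_⟩, hj⟩
  · rw [injective_iff_map_eq_zero]
    intro q
    induction q using OreLocalization.ind with | _ t c
    intro hq
    have := hj t c
    rw [hq, mul_zero, eq_comm, map_eq_zero_iff ι h.injective] at this
    rw [this, zero_oreDiv]
  · obtain ⟨c, t, hc, ht⟩ := h.exists_fraction a
    refine ⟨t /ₒ ⟨c, h.mem_nonZeroDivisors hc⟩, hc.mul_left_cancel ?_⟩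
    rw [ht]
    exact hj t ⟨c, h.mem_nonZeroDivisors hc⟩

end IsLeftOrder

theorem numeratorRingHom_mul_oreDiv {R : Type*} [Ring R] {S : Submonoid R} [OreSet S] (r : R)
    (c : S) : (numeratorRingHom (c : R) : OreLocalization S R) * (r /ₒ c) = numeratorRingHom r :=
  OreLocalization.mul_cancel

theorem isUnit_numeratorRingHom {R : Type*} [Ring R] {S : Submonoid R} [OreSet S] (c : S) :
    IsUnit (numeratorRingHom (c : R) : OreLocalization S R) :=
  ⟨numeratorUnit c, rfl⟩

theorem isLeftOrder_numeratorRingHom (R : Type*) [Ring R] [OreSet R⁰] :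
    IsLeftOrder (numeratorRingHom : R →+* LeftQuotientRing R) where
  injective := numeratorHom_inj fun _ hx => hx.1
  exists_fraction q := by
    induction q using OreLocalization.ind with | _ r c
    exact ⟨c, r, isUnit_numeratorRingHom c, numeratorRingHom_mul_oreDiv r c⟩

end LeftOrder

/-! ### Semisimple rings: central idempotents, splitting and length. -/

section Semisimple

variable {A B : Type*} [Ring A] [Ring B]

/-- The bijective `f`-semilinear map `A ⧸ ker f → B` identifies the two lattices of submodules. -/
theorem RingHom.length_quotient_ker (f : A →+* B) (hf : Function.Surjective f) :
    Module.length A (A ⧸ RingHom.ker f) = Module.length B B := by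
  have : RingHomSurjective f := ⟨hf⟩
  let l : (A ⧸ RingHom.ker f) →ₛₗ[f] B :=
    (RingHom.ker f).liftQ f.toSemilinearMap fun _ hx => hx
  have hl : Function.Bijective l := by
    refine ⟨?_, fun b => ?_⟩
    · rw [← LinearMap.ker_eq_bot]
      exact Submodule.ker_liftQ_eq_bot _ _ _ fun _ hx => hx
    · obtain ⟨a, rfl⟩ := hf b
      exact ⟨Submodule.Quotient.mk a, rfl⟩
  rw [← WithBot.coe_inj, Module.coe_length, Module.coe_length]
  exact Order.krullDim_eq_of_orderIso (Submodule.orderIsoMapComapOfBijective l hl)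

variable [IsSemisimpleRing A]

/-- A semisimple ring is von Neumann regular. -/
theorem IsSemisimpleRing.exists_mul_mul_eq (x : A) : ∃ a, x * a * x = x := by
  obtain ⟨e, he, hx⟩ := IsSemisimpleRing.ideal_eq_span_idempotent (Ideal.span {x})
  obtain ⟨a, ha⟩ := Ideal.mem_span_singleton'.1 (hx ▸ Ideal.mem_span_singleton_self e)
  obtain ⟨b, hb⟩ := Ideal.mem_span_singleton'.1 (hx ▸ Ideal.mem_span_singleton_self x)
  exact ⟨a, by rw [mul_assoc, ha, ← hb, mul_assoc, he.eq]⟩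

/-- A two-sided ideal of a semisimple ring is generated by a central idempotent. -/
theorem IsSemisimpleRing.exists_central_idempotent (I : Ideal A) [I.IsTwoSided] :
    ∃ e ∈ I, (∀ x, x * e = e * x) ∧ ∀ x ∈ I, x * e = x := by
  obtain ⟨e, he, hI⟩ := IsSemisimpleRing.ideal_eq_span_idempotent I
  have heI : e ∈ I := hI ▸ Ideal.mem_span_singleton_self e
  have hmul : ∀ x ∈ I, x * e = x := fun x hx => by
    rw [hI] at hx
    obtain ⟨a, rfl⟩ := Ideal.mem_span_singleton'.1 hx
    rw [mul_assoc, he.eq]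
  refine ⟨e, heI, fun x => ?_, hmul⟩
  have h1 : ∀ y, e * y * e = e * y := fun y => hmul _ (I.mul_mem_right y heI)
  -- The commutator `z = x e - e x` satisfies `z e = z` and `e z = 0`. As `e a = e a e`, this gives
  -- `z = z a z = z e a z = z e a (e z) = 0`.
  obtain ⟨a, ha⟩ := IsSemisimpleRing.exists_mul_mul_eq (x * e - e * x)
  have hz : x * e - e * x = 0 := by
    have h2 : x * e - e * x = x * e - e * x * e := by rw [h1]
    have h3 : (x * e - e * x) * e = x * e - e * x := by
      rw [sub_mul, h1, mul_assoc, he.eq]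
    have h4 : e * (x * e - e * x) = 0 := by
      rw [h2, mul_sub, ← mul_assoc, ← mul_assoc, ← mul_assoc, he.eq, sub_self]
    calc x * e - e * x = (x * e - e * x) * e * a * (x * e - e * x) := by rw [h3, ha]
      _ = (x * e - e * x) * (e * a * e) * (x * e - e * x) := by rw [h1]; noncomm_ring
      _ = (x * e - e * x) * (e * a) * (e * (x * e - e * x)) := by noncomm_ring
      _ = 0 := by rw [h4, mul_zero]
  exact sub_eq_zero.1 hz

theorem leftUdim_eq_add_length_ker (f : A →+* B) (hf : Function.Surjective f) :
    leftUdim A = leftUdim B + Module.length A (RingHom.ker f) := by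
  have := f.isSemisimpleRing_of_surjective hf
  rw [leftUdim, leftUdim, udim_eq_length, udim_eq_length, ← f.length_quotient_ker hf, add_comm]
  exact Module.length_eq_add_of_exact (RingHom.ker f).subtype (RingHom.ker f).mkQ
    (Submodule.subtype_injective _) (Submodule.mkQ_surjective _) (LinearMap.exact_subtype_mkQ _)

/-- A surjective homomorphism from a semisimple ring splits as a projection. -/
theorem exists_ringEquiv_ker_prod (f : A →+* B) (hf : Function.Surjective f) :
    ∃ e : A ≃+* RingHom.ker f × B, (∀ a, (e a).2 = f a) ∧ ∀ k : RingHom.ker f, e k = (k, 0) := by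
  obtain ⟨e, he, hcomm, hmul⟩ := IsSemisimpleRing.exists_central_idempotent (RingHom.ker f)
  have hfe : f e = 0 := he
  -- The inverse sends `(k, b)` to `k + b' (1 - e)` for any lift `b'` of `b`; the choice is harmless
  -- because `1 - e` kills the kernel.
  refine ⟨
    { toFun := fun a => (⟨a * e, (RingHom.ker f).mul_mem_left a he⟩, f a)
      invFun := fun p => p.1 + Function.surjInv hf p.2 * (1 - e)
      left_inv := fun a => ?_
      right_inv := fun p => ?_
      map_mul' := fun a b => ?_
      map_add' := fun a b => ?_ }, fun a => rfl, fun k => ?_⟩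
  · have hk : Function.surjInv hf (f a) - a ∈ RingHom.ker f := by
      rw [RingHom.mem_ker, map_sub, Function.surjInv_eq hf, sub_self]
    have := hmul _ hk
    change a * e + Function.surjInv hf (f a) * (1 - e) = a
    rw [sub_mul] at this
    have h3 : Function.surjInv hf (f a) * e = Function.surjInv hf (f a) - a + a * e := by
      rw [← this, sub_add_cancel]
    rw [mul_sub, mul_one, h3]
    abel
  · refine Prod.ext (Subtype.ext ?_) ?_
    · change (p.1 + Function.surjInv hf p.2 * (1 - e)) * e = p.1
      rw [add_mul, mul_assoc, sub_mul, one_mul, hmul e he, sub_self, mul_zero, add_zero,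
        hmul _ p.1.2]
    · change f (p.1 + Function.surjInv hf p.2 * (1 - e)) = p.2
      rw [map_add, map_mul, map_sub, map_one, hfe, sub_zero, mul_one, Function.surjInv_eq hf,
        RingHom.mem_ker.1 p.1.2, zero_add]
  · refine Prod.ext (Subtype.ext ?_) (map_mul f a b)
    change a * b * e = a * e * (b * e)
    rw [mul_assoc a e, ← hcomm, mul_assoc b, hmul e he, mul_assoc]
  · exact Prod.ext (Subtype.ext (add_mul a b e)) (map_add f a b)
  · exact Prod.ext (Subtype.ext (hmul k k.2)) k.2

/-- Wedderburn–Artin: a semisimple ring is a finite product of simple Artinian rings. -/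
theorem exists_ringEquiv_pi_simple_artinian (A : Type u) [Ring A] [IsSemisimpleRing A] :
    ∃ (s : ℕ) (Q : Fin s → Type u) (_ : ∀ i, Ring (Q i)),
      (∀ i, IsSimpleRing (Q i) ∧ IsArtinianRing (Q i)) ∧ Nonempty (A ≃+* ∀ i, Q i) := by
  obtain ⟨n, D, d, _, hd, ⟨e⟩⟩ := IsSemisimpleRing.exists_ringEquiv_pi_matrix_divisionRing A
  exact ⟨n, fun i => Matrix (Fin (d i)) (Fin (d i)) (D i), fun i => inferInstance,
    fun i => ⟨inferInstance, inferInstance⟩, ⟨e⟩⟩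

end Semisimple

/-! ### The extension of σ to the quotient ring, and σ(R) as a left order in its image. -/

section Extension

/-- Let `R` be a semiprime left order in a semisimple ring `A`. A quotient of `R` whose kernel is
cut out by an ideal of `A` is semiprime. -/
theorem IsSemiprimeRing.of_surjective {R A S B : Type*} [Ring R] [Ring A] [Ring S] [Ring B]
    [IsSemisimpleRing A] (hsp : IsSemiprimeRing R) {ι : R →+* A} (h : IsLeftOrder ι)
    (f : A →+* B) {g : R →+* S} (hg : Function.Surjective g)
    (hfg : ∀ r, g r = 0 ↔ f (ι r) = 0) : IsSemiprimeRing S := by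
  obtain ⟨e, he, hcomm, hmul⟩ := IsSemisimpleRing.exists_central_idempotent (RingHom.ker f)
  refine isSemiprimeRing_of_forall fun x hx => ?_
  obtain ⟨y, rfl⟩ := hg x
  -- Writing `1 - e = c⁻¹ d` moves the argument into `R`: `y r y` lies in the kernel, so `d` kills
  -- it, and semiprimeness of `R` applies to `d y`. Then `(1 - e) y = 0`, so `y` is in the kernel.
  obtain ⟨c, d, hc, hd⟩ := h.exists_fraction (1 - e)
  have hz : ∀ r, (1 - e) * ι (y * r * y) = 0 := fun r => by
    have : f (ι (y * r * y)) = 0 := by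
      rw [← hfg, map_mul, map_mul]; exact hx _
    rw [sub_mul, one_mul, ← hcomm, hmul _ this, sub_self]
  have hdy : d * y = 0 := hsp.eq_zero fun r => h.injective (by
    calc ι (d * y * r * (d * y)) = ι d * ι (y * (r * d) * y) := by
          rw [← map_mul]; congr 1; noncomm_ring
      _ = ι 0 := by rw [← hd, mul_assoc, hz, mul_zero, map_zero])
  have hey : (1 - e) * ι y = 0 := hc.mul_right_eq_zero.1 (by
    rw [← mul_assoc, hd, ← map_mul, hdy, map_zero])
  rw [sub_mul, one_mul, sub_eq_zero] at hey
  rw [hfg, hey, map_mul, RingHom.mem_ker.1 he, zero_mul]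

variable {R : Type u} [Ring R] {σ : R →+* R}

/-- An endomorphism that respects regular elements extends to the left quotient ring. -/
theorem exists_extension_leftQuotientRing [OreSet R⁰] (hσ : ∀ c ∈ R⁰, σ c ∈ R⁰) :
    ∃ σQ : LeftQuotientRing R →+* LeftQuotientRing R,
      ∀ (r : R) (c : R⁰), σQ (r /ₒ c) = σ r /ₒ ⟨σ c, hσ c c.2⟩ := by
  let f : R →+* LeftQuotientRing R := numeratorRingHom.comp σ
  have hu : ∀ c : R⁰, IsUnit ((f : R →* LeftQuotientRing R).comp R⁰.subtype c) := fun c =>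
    isUnit_numeratorRingHom ⟨σ c, hσ c c.2⟩
  have hf : ∀ c : R⁰, f c = IsUnit.liftRight _ hu c := fun c =>
    (IsUnit.coe_liftRight _ hu c).symm
  refine ⟨universalHom f (IsUnit.liftRight _ hu) hf, fun r c => ?_⟩
  rw [universalHom_apply, Units.inv_mul_eq_iff_eq_mul, ← hf]
  exact (numeratorRingHom_mul_oreDiv (σ r) ⟨σ c, hσ c c.2⟩).symm

variable [OreSet R⁰] {σQ : LeftQuotientRing R →+* LeftQuotientRing R}

/-- The canonical map from `σ(R)` to `σ_Q(Q_l(R))`. -/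
noncomputable def rangeNumeratorHom
    (hQ : ∀ r, σQ (numeratorRingHom r) = numeratorRingHom (σ r)) : σ.range →+* σQ.range :=
  (numeratorRingHom.comp σ.range.subtype).codRestrict σQ.range (by
    rintro ⟨_, r, rfl⟩
    exact ⟨numeratorRingHom r, hQ r⟩)

variable (hQ : ∀ r, σQ (numeratorRingHom r) = numeratorRingHom (σ r))

include hQ

theorem rangeNumeratorHom_rangeRestrict (r : R) :
    rangeNumeratorHom hQ (σ.rangeRestrict r) = σQ.rangeRestrict (numeratorRingHom r) :=
  Subtype.ext (hQ r).symm

theorem rangeNumeratorHom_mul_rangeRestrict (r : R) (c : R⁰) :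
    rangeNumeratorHom hQ (σ.rangeRestrict c) * σQ.rangeRestrict (r /ₒ c) =
      rangeNumeratorHom hQ (σ.rangeRestrict r) := by
  rw [rangeNumeratorHom_rangeRestrict, rangeNumeratorHom_rangeRestrict, ← map_mul,
    numeratorRingHom_mul_oreDiv]

theorem isLeftOrder_rangeNumeratorHom : IsLeftOrder (rangeNumeratorHom hQ) where
  injective x y hxy := Subtype.ext ((isLeftOrder_numeratorRingHom R).injective
    (congrArg Subtype.val hxy))
  exists_fraction := by
    rintro ⟨_, q, rfl⟩
    induction q using OreLocalization.ind with | _ r c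
    refine ⟨σ.rangeRestrict c, σ.rangeRestrict r, ?_, rangeNumeratorHom_mul_rangeRestrict hQ r c⟩
    rw [rangeNumeratorHom_rangeRestrict]
    exact (isUnit_numeratorRingHom c).map σQ.rangeRestrict

theorem ker_eq_comap_ker_extension :
    RingHom.ker σ = (RingHom.ker σQ).comap (numeratorRingHom : R →+* LeftQuotientRing R) := by
  ext r
  rw [Ideal.mem_comap, RingHom.mem_ker, RingHom.mem_ker, hQ,
    map_eq_zero_iff _ (isLeftOrder_numeratorRingHom R).injective]

theorem isSemiprimeRing_range [IsSemisimpleRing (LeftQuotientRing R)] (hsp : IsSemiprimeRing R) :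
    IsSemiprimeRing σ.range := by
  refine hsp.of_surjective (isLeftOrder_numeratorRingHom R) σQ σ.rangeRestrict_surjective
    fun r => ?_
  have h := congrArg (r ∈ ·) (ker_eq_comap_ker_extension hQ)
  rw [← RingHom.mem_ker, RingHom.ker_rangeRestrict]
  exact h.to_iff

end Extension

/-! ### The main theorem. -/

theorem mainTheorem5 (R : Type u) [Ring R] (hsp : IsSemiprimeRing R) (hG : IsLeftGoldieRing R)
    (σ : R →+* R) (hσ : ∀ c ∈ R⁰, σ c ∈ R⁰) :
    -- the image is a semiprime left Goldie ring
    (IsSemiprimeRing σ.range ∧ IsLeftGoldieRing σ.range) ∧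
    -- both left quotient rings exist
    Nonempty (OreSet R⁰) ∧ Nonempty (OreSet (σ.range)⁰) ∧
    ∀ [OreSet R⁰] [OreSet (σ.range)⁰],
      -- `Q_l(R)` is a finite product of simple Artinian rings
      (∃ (s : ℕ) (Q : Fin s → Type u) (_ : ∀ i, Ring (Q i)),
        (∀ i, IsSimpleRing (Q i) ∧ IsArtinianRing (Q i)) ∧
        Nonempty (LeftQuotientRing R ≃+* ∀ i, Q i)) ∧
      -- the extension `σQ` of `σ` to `Q_l(R)` and the map `φ : Q_l(R) → Q_l(σ(R))`
      ∃ (σQ : LeftQuotientRing R →+* LeftQuotientRing R)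
        (φ : LeftQuotientRing R →+* LeftQuotientRing σ.range),
        (∀ (r : R) (c : R⁰), σQ (r /ₒ c) = σ r /ₒ ⟨σ c, hσ c c.2⟩) ∧
        (∀ (r : R) (c : R⁰), φ (r /ₒ c) =
          σ.rangeRestrict r /ₒ ⟨σ.rangeRestrict c, rangeRestrict_mem_nonZeroDivisors hσ c⟩) ∧
        -- `φ` is a split epimorphism: `Q_l(R) ≃ ker φ × Q_l(σ(R))` with `φ` as second projection
        Function.Surjective φ ∧
        (∃ e : LeftQuotientRing R ≃+* RingHom.ker φ × LeftQuotientRing σ.range,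
          (∀ q, (e q).2 = φ q) ∧ ∀ k : RingHom.ker φ, e k = (k, 0)) ∧
        -- `Q_l(σ(R)) = σ(Q_l(R))`, compatibly with the inclusion of `σ(R)` in `R`
        (∃ j : LeftQuotientRing σ.range ≃+* σQ.range,
          (∀ x : σ.range, (j (x /ₒ 1) : LeftQuotientRing R) = (x : R) /ₒ 1) ∧
          ∀ q, (j (φ q) : LeftQuotientRing R) = σQ q) ∧
        -- the uniform dimensions
        leftUdim R = leftUdim (LeftQuotientRing R) ∧
        leftUdim (LeftQuotientRing R) = leftUdim (LeftQuotientRing σ.range) +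
          Module.length (LeftQuotientRing R) (RingHom.ker σQ) ∧
        leftUdim R = leftUdim σ.range + udim R (RingHom.ker σ) := by
  have hsemi : ∀ [OreSet R⁰], IsSemisimpleRing (LeftQuotientRing R) :=
    (isLeftOrder_numeratorRingHom R).isSemisimpleRing hsp hG
      fun c hc => isUnit_numeratorRingHom ⟨c, hc⟩
  have hnum : ∀ [OreSet R⁰] {σQ : LeftQuotientRing R →+* LeftQuotientRing R},
      (∀ (r : R) (c : R⁰), σQ (r /ₒ c) = σ r /ₒ ⟨σ c, hσ c c.2⟩) →
      ∀ r, σQ (numeratorRingHom r) = numeratorRingHom (σ r) := fun h r =>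
    (h r 1).trans (congrArg (σ r /ₒ ·) (Subtype.ext (map_one σ)))
  obtain ⟨hOre⟩ := nonempty_oreSet_nonZeroDivisors hsp hG
  have hT : IsSemiprimeRing σ.range ∧ IsLeftGoldieRing σ.range ∧ Nonempty (OreSet (σ.range)⁰) := by
    obtain ⟨σQ, hσQ⟩ := exists_extension_leftQuotientRing hσ
    have := hsemi
    have := σQ.rangeRestrict.isSemisimpleRing_of_surjective σQ.rangeRestrict_surjective
    have h := isLeftOrder_rangeNumeratorHom (hnum hσQ)
    exact ⟨isSemiprimeRing_range (hnum hσQ) hsp, h.isLeftGoldieRing, h.nonempty_oreSet⟩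
  refine ⟨⟨hT.1, hT.2.1⟩, ⟨hOre⟩, hT.2.2, ?_⟩
  -- The remaining claims concern arbitrary Ore structures, so the one chosen for the existence
  -- statements is discarded.
  clear hOre hT
  intro _ _
  have := hsemi
  obtain ⟨σQ, hσQ⟩ := exists_extension_leftQuotientRing hσ
  have hQ := hnum hσQ
  have := σQ.rangeRestrict.isSemisimpleRing_of_surjective σQ.rangeRestrict_surjective
  have hι := isLeftOrder_rangeNumeratorHom hQ
  obtain ⟨j, hj⟩ := hι.exists_ringEquiv
  have hjφ : ∀ q, j (j.symm (σQ.rangeRestrict q)) = σQ.rangeRestrict q :=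
    fun q => j.apply_symm_apply _
  have hφs : Function.Surjective (j.symm.toRingHom.comp σQ.rangeRestrict) :=
    j.symm.surjective.comp σQ.rangeRestrict_surjective
  -- Here φ is `j⁻¹ ∘ σQ`, so it has the kernel of `σQ`, the one in the length formula.
  have hker : RingHom.ker (j.symm.toRingHom.comp σQ.rangeRestrict) = RingHom.ker σQ := by
    ext q
    rw [← RingHom.ker_rangeRestrict σQ, RingHom.mem_ker, RingHom.mem_ker]
    exact j.symm.map_eq_zero_iff
  have hudim := leftUdim_eq_add_length_ker _ hφs
  rw [hker] at hudim
  have hR := (isLeftOrder_numeratorRingHom R).leftUdim_eq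
  refine ⟨exists_ringEquiv_pi_simple_artinian _, σQ, j.symm.toRingHom.comp σQ.rangeRestrict, hσQ,
    fun r c => ?_, hφs, exists_ringEquiv_ker_prod _ hφs,
    ⟨j, fun x => ?_, fun q => congrArg Subtype.val (hjφ q)⟩, hR, hudim, ?_⟩
  · refine j.injective ((hjφ _).trans ?_)
    have hc := rangeRestrict_mem_nonZeroDivisors hσ c
    refine (hι.isUnit_map hc).mul_left_cancel ?_
    rw [rangeNumeratorHom_mul_rangeRestrict]
    exact (hj _ ⟨_, hc⟩).symm
  · have := hj x 1
    rw [Submonoid.coe_one, map_one, one_mul] at this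
    rw [this]
    rfl
  · rw [hR, hudim, (isLeftOrder_numeratorRingHom σ.range).leftUdim_eq,
      ker_eq_comap_ker_extension hQ, (isLeftOrder_numeratorRingHom R).udim_comap, udim_eq_length]
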